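/- **Proposition (composition of the two-type Yule process).** Consider particles of two types, $\mathsf x$ and $\mathsf y$. Each particle lives, independently of all others, an exponential time of rate $1$ and then disintegrates into two particles of the other type. At time $0$ there is a single particle, of type $\mathsf x$. For $t\ge 0$ let $N_t\in\{0,1,2,\dots\}\cup\{\infty\}$ be the number of particles of type $\mathsf x$ present at time $t$. Let $H_{n,k}$ be the number of histories of length $n$ of the urn in which, at each step, one ball is chosen and replaced by two balls of the other type ($\mathsf x\to\mathsf y\mathsf y$, $\mathsf y\to\mathsf x\mathsf x$), that start with one ball $\mathsf x$ and end with exactly $k$ balls $\mathsf x$ and $n+1-k$ balls $\mathsf y$ (a history records which ball of the current word is replaced at each step). Let $\operatorname{sm}$ be Dixon's function on the real line, that is, the first component of the solution of $\operatorname{sm}'=\operatorname{cm}^2$, $\operatorname{cm}'=-\operatorname{sm}^2$, $\operatorname{sm}(0)=0$, $\operatorname{cm}(0)=1$ on its maximal interval of existence, and let $\operatorname{smh}(z)=-\operatorname{sm}(-z)$. Then for every $t\ge0$ the following hold. 1. For every complex $x$ with $|x|\le1$, the double series $\sum_{n,k\ge0}H_{n,k}x^k\frac{(1-e^{-t})^n}{n!}$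 converges absolutely, and $$\sum_{k\ge0}\mathbb P(N_t=k)\,x^k \;=\; e^{-t}\sum_{n,k\ge0}H_{n,k}\,x^k\,\frac{(1-e^{-t})^n}{n!}.$$ (For $x=1$ this contains $\mathbb P(N_t<\infty)=1$.) 2. For every real $x$ with $|x|<1$, the probability generating function of $N_t$ is $$\sum_{k\ge0}\mathbb P(N_t=k)\,x^k \;=\; e^{-t}(1-x^3)^{1/3}\operatorname{smh}\!\left((1-x^3)^{1/3}(1-e^{-t})+\int_0^{x(1-x^3)^{-1/3}}\frac{ds}{(1+s^3)^{2/3}}\right).$$ -/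

import Mathlib

open MeasureTheory ProbabilityTheory Set

noncomputable section

/-! ### The two types -/

/-- The two types of balls of the urn (equivalently, of particles): `x` is the first type,
`y` is the second type. -/
inductive Ball
  | x
  | y
  deriving DecidableEq

/-- The opposite type. -/
def Ball.other : Ball → Ball
  | .x => .y
  | .y => .x

/-! ### The urn with placement matrix `(-1, 2; 2, -1)` -/

/-- Apply one of the rules `x → yy`, `y → xx` to the letter of the word `w` at position `i`. -/
def urnReplace (w : List Ball) (i : ℕ) : List Ball :=
  match w.drop i with
  | [] => w
  | b :: v => w.take i ++ b.other :: b.other :: v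

/-- A history of length `n` of the urn started with one ball: at step `i` (counted from `0`) the
current word has `i + 1` letters, and the history records the position of the letter
that is replaced. -/
abbrev UrnHistory (n : ℕ) : Type := (i : Fin n) → Fin (i + 1)

/-- The word reached by a history that starts with the one-letter word `x`. -/
def UrnHistory.word {n : ℕ} (h : UrnHistory n) : List Ball :=
  (List.ofFn fun i => (h i : ℕ)).foldl urnReplace [Ball.x]

/-- `urnCount n k` is the number of histories of length `n` that start with the word `x` and end
in a word with exactly `k` letters `x`. -/
def urnCount (n k : ℕ) : ℕ :=
  Fintype.card {h : UrnHistory n // h.word.count Ball.x = k}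

/-! ### The Dixonian functions on the real line -/

/-- `s, c` solve Dixon's system `s' = c ^ 2`, `c' = - s ^ 2`, `s 0 = 0`, `c 0 = 1` on the open
interval `(a, b)`, which contains `0`. -/
structure IsDixonSolution (a b : ℝ) (s c : ℝ → ℝ) : Prop where
  left_neg : a < 0
  right_pos : 0 < b
  s_zero : s 0 = 0
  c_zero : c 0 = 1
  hasDerivAt_s : ∀ z ∈ Ioo a b, HasDerivAt s (c z ^ 2) z
  hasDerivAt_c : ∀ z ∈ Ioo a b, HasDerivAt c (-s z ^ 2) z

/-- Two solutions of Dixon's system agree where both are defined. -/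
theorem IsDixonSolution.eq {a b a' b' : ℝ} {s c s' c' : ℝ → ℝ}
    (h : IsDixonSolution a b s c) (h' : IsDixonSolution a' b' s' c') {z : ℝ}
    (hz : z ∈ Ioo a b) (hz' : z ∈ Ioo a' b') : s z = s' z := by
  set v : ℝ × ℝ → ℝ × ℝ := fun p => (p.2 ^ 2, -p.1 ^ 2) with hv
  have hvl : LocallyLipschitz v :=
    (show ContDiff ℝ 1 v by rw [hv]; fun_prop).locallyLipschitz
  -- both solutions on the common interval `I`
  have hI : ∀ u ∈ Ioo (max a a') (min b b'), u ∈ Ioo a b ∧ u ∈ Ioo a' b' := fun u hu =>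
    ⟨⟨(le_max_left _ _).trans_lt hu.1, hu.2.trans_le (min_le_left _ _)⟩,
      ⟨(le_max_right _ _).trans_lt hu.1, hu.2.trans_le (min_le_right _ _)⟩⟩
  have h0 : (0 : ℝ) ∈ Ioo (max a a') (min b b') :=
    ⟨max_lt h.left_neg h'.left_neg, lt_min h.right_pos h'.right_pos⟩
  have hzI : z ∈ Ioo (max a a') (min b b') :=
    ⟨max_lt hz.1 hz'.1, lt_min hz.2 hz'.2⟩
  have d1 : ∀ u ∈ Ioo (max a a') (min b b'),
      HasDerivAt (fun u => (s u, c u)) (v (s u, c u)) u := fun u hu =>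
    (h.hasDerivAt_s u (hI u hu).1).prodMk (h.hasDerivAt_c u (hI u hu).1)
  have d2 : ∀ u ∈ Ioo (max a a') (min b b'),
      HasDerivAt (fun u => (s' u, c' u)) (v (s' u, c' u)) u := fun u hu =>
    (h'.hasDerivAt_s u (hI u hu).2).prodMk (h'.hasDerivAt_c u (hI u hu).2)
  obtain ⟨p, hp, hp'⟩ := exists_between (lt_min h0.1 hzI.1)
  obtain ⟨q, hq', hq⟩ := exists_between (max_lt h0.2 hzI.2)
  have hsub : Icc p q ⊆ Ioo (max a a') (min b b') := fun u hu =>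
    ⟨hp.trans_le hu.1, hu.2.trans_lt hq⟩
  have hK : IsCompact ((fun u => (s u, c u)) '' Icc p q ∪ (fun u => (s' u, c' u)) '' Icc p q) :=
    (isCompact_Icc.image_of_continuousOn
      fun u hu => (d1 u (hsub hu)).continuousAt.continuousWithinAt).union
    (isCompact_Icc.image_of_continuousOn
      fun u hu => (d2 u (hsub hu)).continuousAt.continuousWithinAt)
  obtain ⟨K, hKv⟩ := hvl.locallyLipschitzOn.exists_lipschitzOnWith_of_compact hK
  have key := ODE_solution_unique_of_mem_Ioo (v := fun _ => v) (s := fun _ => _) (t₀ := 0)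
    (a := p) (b := q) (fun _ _ => hKv)
    ⟨hp'.trans_le (min_le_left _ _), (le_max_left _ _).trans_lt hq'⟩
    (fun u hu => ⟨d1 u (hsub (Ioo_subset_Icc_self hu)),
      Or.inl ⟨u, Ioo_subset_Icc_self hu, rfl⟩⟩)
    (fun u hu => ⟨d2 u (hsub (Ioo_subset_Icc_self hu)),
      Or.inr ⟨u, Ioo_subset_Icc_self hu, rfl⟩⟩)
    (by simp [h.s_zero, h.c_zero, h'.s_zero, h'.c_zero])
  exact congrArg Prod.fst
    (key (x := z) ⟨hp'.trans_le (min_le_right _ _), (le_max_right _ _).trans_lt hq'⟩)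

open Classical in
/-- Dixon's function `sm` on the real line: the first component of the solution of
`sm' = cm ^ 2`, `cm' = - sm ^ 2`, `sm 0 = 0`, `cm 0 = 1`, at every point of its maximal interval of
existence (and the placeholder value `0` elsewhere). -/
def dixonSm (z : ℝ) : ℝ :=
  if h : ∃ v : ℝ, ∃ (a b : ℝ) (s c : ℝ → ℝ), IsDixonSolution a b s c ∧ z ∈ Ioo a b ∧ s z = v
  then h.choose else 0

/-- `dixonSm` agrees with every solution of Dixon's system. -/
theorem IsDixonSolution.dixonSm_eq {a b : ℝ} {s c : ℝ → ℝ} (h : IsDixonSolution a b s c) {z : ℝ}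
    (hz : z ∈ Ioo a b) : dixonSm z = s z := by
  have hex : ∃ v : ℝ, ∃ (a b : ℝ) (s c : ℝ → ℝ),
      IsDixonSolution a b s c ∧ z ∈ Ioo a b ∧ s z = v := ⟨s z, a, b, s, c, h, hz, rfl⟩
  obtain ⟨a', b', s', c', h', hz', hv⟩ := hex.choose_spec
  rw [dixonSm, dif_pos hex, ← hv]
  exact h'.eq h hz' hz

/-- The function `smh z = - sm (- z)`. -/
def dixonSmh (z : ℝ) : ℝ := -dixonSm (-z)

/-- The closed form `(1 - x^3)^(1/3) smh ((1 - x^3)^(1/3) z + ∫_0^(x (1 - x^3)^(-1/3)) ds / (1 + s^3)^(2/3))`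
of the bivariate generating function of urn histories. -/
def urnClosedForm (x z : ℝ) : ℝ :=
  (1 - x ^ 3) ^ (1 / 3 : ℝ) *
    dixonSmh ((1 - x ^ 3) ^ (1 / 3 : ℝ) * z +
      ∫ s in (0 : ℝ)..(x * (1 - x ^ 3) ^ (-(1 / 3) : ℝ)), 1 / (1 + s ^ 3) ^ (2 / 3 : ℝ))

/-! ### The two-type Yule process -/

/-- A particle is named by its line of descent: `[]` is the initial particle, and the two offspring
of `v` are `false :: v` and `true :: v`. -/
abbrev Particle : Type := List Bool

/-- The type of a particle: the initial one has type `x`, and a particle disintegrates into two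
particles of the other type. -/
def Particle.type : Particle → Ball
  | [] => Ball.x
  | _ :: v => (Particle.type v).other

/-- The time of birth of a particle, given the lifetimes `T` of all particles: the initial particle
is born at time `0`, and the others at the moment at which their parent disintegrates. -/
def birthTime (T : Particle → ℝ) : Particle → ℝ
  | [] => 0
  | _ :: v => birthTime T v + T v

/-- The set of particles that are present at time `t`, given the lifetimes `T`. -/
def aliveAt (T : Particle → ℝ) (t : ℝ) : Set Particle :=
  {v | birthTime T v ≤ t ∧ t < birthTime T v + T v}

/-- The number of particles of type `x` that are present at time `t`. -/
def yuleCount (T : Particle → ℝ) (t : ℝ) : ℕ∞ :=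
  {v ∈ aliveAt T t | Particle.type v = Ball.x}.encard

/-- The random lifetimes that drive the Yule process: they are independent, and each is exponential
of rate `1`. -/
structure IsYuleLifetimes {Ω : Type*} [MeasurableSpace Ω] (μ : Measure Ω)
    (T : Particle → Ω → ℝ) : Prop where
  hasLaw : ∀ v, HasLaw (T v) (expMeasure 1) μ
  indep : iIndepFun T μ

end

/-!
Put `D = y² ∂/∂x + x² ∂/∂y`. The histories of length `n` of the urn started with the ball `c` are
enumerated, according to their final composition, by the polynomial `Dⁿ c`. By the Leibniz rule for
`Dⁿ`, their exponential generating functions `H_c` satisfy `H_x' = H_y²` and `H_y' = H_x²`; setting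
`y = 1` marks the balls `x` only.

Conditioning the Yule process on the first disintegration gives Kolmogorov's backward equations
`G_x' = G_y² - G_x` and `G_y' = G_x² - G_y`, where `G_c` is the probability generating function of
the number of particles of type `x` in the process started with a particle of type `c`. The
functions `t ↦ e⁻ᵗ H_c (1 - e⁻ᵗ)` solve the same initial value problem, so they are the `G_c`.

Finally `H_y³ - H_x³` is constant, so `H_x' = (H_x³ + 1 - x³)^(2/3)`. After division by
`(1 - x³)^(1/3)` this separable equation is inverted by the Abelian integral
`∫ ds / (1 + s³)^(2/3)`, whose inverse is `smh`.
-/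

noncomputable section

/-! ### Urn histories as monomials -/

open Finset.HasAntidiagonal (antidiagonal)

theorem derivation_iterate_mul {R A : Type*} [CommSemiring R] [CommSemiring A] [Algebra R A]
    (D : Derivation R A A) (n : ℕ) (a b : A) :
    D^[n] (a * b) =
      ∑ p ∈ antidiagonal n, n.choose p.1 • (D^[p.1] a * D^[p.2] b) := by
  induction n with
  | zero => simp
  | succ n ih =>
    rw [Finset.sum_antidiagonal_choose_succ_nsmul (fun i j => D^[i] a * D^[j] b)]
    simp only [Function.iterate_succ_apply', ih, map_sum, map_nsmul, Derivation.leibniz,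
      smul_eq_mul, smul_add, Finset.sum_add_distrib]
    congr 1
    refine Finset.sum_congr rfl fun p hp => ?_
    rw [n.choose_symm_of_eq_add (Finset.HasAntidiagonal.mem_antidiagonal.1 hp).symm, mul_comm]

theorem Ball.other_eq_iff {c d : Ball} : c.other = d ↔ c = d.other := by
  cases c <;> cases d <;> simp [Ball.other]

theorem urnReplace_cons_zero (b : Ball) (v : List Ball) :
    urnReplace (b :: v) 0 = b.other :: b.other :: v := rfl

theorem urnReplace_cons_succ (b : Ball) (v : List Ball) (i : ℕ) :
    urnReplace (b :: v) (i + 1) = b :: urnReplace v i := by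
  unfold urnReplace
  rw [List.drop_succ_cons]
  cases v.drop i <;> simp

theorem length_urnReplace {w : List Ball} {i : ℕ} (hi : i < w.length) :
    (urnReplace w i).length = w.length + 1 := by
  induction w generalizing i with
  | nil => simp at hi
  | cons b v ih =>
    cases i with
    | zero => rfl
    | succ i => simp [urnReplace_cons_succ, ih (Nat.lt_of_succ_lt_succ hi)]

namespace UrnHistory

theorem word_snoc {n : ℕ} (h : UrnHistory n) (j : Fin (n + 1)) :
    word (n := n + 1) (Fin.snoc (α := fun i : Fin (n + 1) => Fin (i + 1)) h j) =
      urnReplace h.word j := by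
  unfold word
  rw [List.ofFn_succ', List.concat_eq_append, List.foldl_append]
  simp

theorem length_word {n : ℕ} (h : UrnHistory n) : h.word.length = n + 1 := by
  induction n with
  | zero => simp [word]
  | succ n ih =>
    rw [← Fin.snoc_init_self h, word_snoc, length_urnReplace, ih]
    rw [ih]
    exact (h (Fin.last n)).2

end UrnHistory

/-- The monomial that records the composition of a word. -/
def wordMonomial (w : List Ball) : MvPolynomial Ball ℕ := (w.map MvPolynomial.X).prod

theorem wordMonomial_cons (b : Ball) (w : List Ball) :
    wordMonomial (b :: w) = MvPolynomial.X b * wordMonomial w := by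
  simp [wordMonomial]

/-- The derivation `y² ∂/∂x + x² ∂/∂y`, which describes one step of the urn: applied to the
monomial of a word, it replaces each letter in turn and adds up the results. -/
def urnDerivation : Derivation ℕ (MvPolynomial Ball ℕ) (MvPolynomial Ball ℕ) :=
  MvPolynomial.mkDerivation ℕ fun b => MvPolynomial.X b.other ^ 2

theorem urnDerivation_X (b : Ball) :
    urnDerivation (MvPolynomial.X b) = MvPolynomial.X b.other * MvPolynomial.X b.other := by
  rw [urnDerivation, MvPolynomial.mkDerivation_X, sq]

theorem urnDerivation_wordMonomial (w : List Ball) :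
    urnDerivation (wordMonomial w) =
      ∑ i ∈ Finset.range w.length, wordMonomial (urnReplace w i) := by
  induction w with
  | nil => simp [wordMonomial]
  | cons b v ih =>
    rw [wordMonomial_cons, Derivation.leibniz, ih, urnDerivation_X, List.length_cons,
      Finset.sum_range_succ']
    simp only [urnReplace_cons_succ, urnReplace_cons_zero, wordMonomial_cons, smul_eq_mul,
      Finset.mul_sum]
    ring

theorem sum_wordMonomial_word (n : ℕ) :
    ∑ h : UrnHistory n, wordMonomial h.word = urnDerivation^[n] (MvPolynomial.X Ball.x) := by
  induction n with
  | zero => simp [UrnHistory.word, wordMonomial]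
  | succ n ih =>
    rw [Function.iterate_succ_apply', ← ih, map_sum,
      ← (Fin.snocEquiv fun i : Fin (n + 1) => Fin (i + 1)).sum_comp, Fintype.sum_prod_type,
      Finset.sum_comm]
    refine Finset.sum_congr rfl fun h _ => ?_
    rw [urnDerivation_wordMonomial, UrnHistory.length_word, Finset.sum_range]
    exact Finset.sum_congr rfl fun j _ => congrArg wordMonomial (UrnHistory.word_snoc h j)

/-- The total weight of the histories of length `n` that start with the ball `b`, where a history
weighs the product of the weights `w` of the letters of its final word. -/
def urnWeightSum {R : Type*} [CommSemiring R] (w : Ball → R) (b : Ball) (n : ℕ) : R :=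
  MvPolynomial.aeval w (urnDerivation^[n] (MvPolynomial.X b))

section UrnWeightSum

variable {R : Type*} [CommSemiring R]

theorem urnWeightSum_zero (w : Ball → R) (b : Ball) : urnWeightSum w b 0 = w b := by
  simp [urnWeightSum]

theorem urnWeightSum_succ (w : Ball → R) (b : Ball) (n : ℕ) :
    urnWeightSum w b (n + 1) = ∑ p ∈ antidiagonal n,
      n.choose p.1 • (urnWeightSum w b.other p.1 * urnWeightSum w b.other p.2) := by
  simp only [urnWeightSum, Function.iterate_succ_apply, urnDerivation_X, derivation_iterate_mul,
    map_sum, map_nsmul, map_mul]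

theorem aeval_mulSingle_wordMonomial (x : R) (u : List Ball) :
    MvPolynomial.aeval (Pi.mulSingle Ball.x x) (wordMonomial u) = x ^ u.count Ball.x := by
  induction u with
  | nil => simp [wordMonomial]
  | cons b u ih =>
    rw [wordMonomial_cons, map_mul, ih, MvPolynomial.aeval_X]
    cases b <;> simp [pow_succ']

theorem urnWeightSum_mulSingle (x : R) (n : ℕ) :
    urnWeightSum (Pi.mulSingle Ball.x x) Ball.x n =
      ∑ h : UrnHistory n, x ^ h.word.count Ball.x := by
  simp only [urnWeightSum, ← sum_wordMonomial_word, map_sum, aeval_mulSingle_wordMonomial]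

theorem hasSum_urnCount [TopologicalSpace R] [ContinuousAdd R] (x : R) (n : ℕ) :
    HasSum (fun k => (urnCount n k : R) * x ^ k)
      (urnWeightSum (Pi.mulSingle Ball.x x) Ball.x n) := by
  have hterm (k : ℕ) : (urnCount n k : R) * x ^ k = ∑ h : UrnHistory n,
      if k = h.word.count Ball.x then x ^ h.word.count Ball.x else 0 := by
    rw [urnCount, Fintype.card_subtype, ← nsmul_eq_mul, ← Finset.sum_const, Finset.sum_filter]
    exact Finset.sum_congr rfl fun h _ => by grind
  simp_rw [urnWeightSum_mulSingle, hterm]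
  exact hasSum_sum fun h _ => hasSum_ite_eq _ _

end UrnWeightSum

/-! ### Exponential generating functions of urn histories -/

section BoundedCoefficients

variable {E : Type*} [NormedAddCommGroup E] [NormedSpace ℝ E] {a : ℕ → E} {C z : ℝ}

theorem norm_pow_smul_le (ha : ∀ n, ‖a n‖ ≤ C) (z : ℝ) (n : ℕ) :
    ‖z ^ n • a n‖ ≤ |z| ^ n * C := by
  rw [norm_smul, norm_pow, Real.norm_eq_abs]
  exact mul_le_mul_of_nonneg_left (ha n) (by positivity)

theorem summable_norm_pow_smul (ha : ∀ n, ‖a n‖ ≤ C) (hz : |z| < 1) :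
    Summable fun n => ‖z ^ n • a n‖ :=
  ((summable_geometric_of_lt_one (abs_nonneg z) hz).mul_right C).of_nonneg_of_le
    (fun _ => norm_nonneg _) (norm_pow_smul_le ha z)

theorem hasDerivAt_tsum_pow_smul [CompleteSpace E] (ha : ∀ n, ‖a n‖ ≤ C) (hz : |z| < 1) :
    HasDerivAt (fun z : ℝ => ∑' n, z ^ n • a n) (∑' n, z ^ n • ((n + 1) • a (n + 1))) z := by
  obtain ⟨r, hzr, hr⟩ := exists_between hz
  have hr0 : 0 < r := (abs_nonneg z).trans_lt hzr
  have hbound : Summable fun n : ℕ => (n * r ^ (n - 1)) * C := by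
    refine Summable.mul_right C ((summable_nat_add_iff 1).1 ?_)
    have hgeom := summable_pow_mul_geometric_of_norm_lt_one 1 (Real.norm_of_nonneg hr0.le ▸ hr)
    simpa [pow_succ, mul_assoc, hr0.ne'] using ((summable_nat_add_iff 1).2 hgeom).mul_right r⁻¹
  have hderiv_le (n : ℕ) (y : ℝ) (hy : y ∈ Metric.ball 0 r) :
      ‖(n * y ^ (n - 1)) • a n‖ ≤ (n * r ^ (n - 1)) * C := by
    rw [norm_smul, norm_mul, norm_pow, Real.norm_natCast]
    have := (mem_ball_zero_iff.1 hy).le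
    gcongr
    exact ha n
  have hderiv := hasDerivAt_tsum_of_isPreconnected (g := fun (n : ℕ) (z : ℝ) => z ^ n • a n)
    (g' := fun (n : ℕ) (z : ℝ) => (n * z ^ (n - 1)) • a n) hbound Metric.isOpen_ball
    (convex_ball 0 r).isPreconnected (fun n y _ => (hasDerivAt_pow n y).smul_const (a n))
    hderiv_le (Metric.mem_ball_self hr0) (summable_norm_pow_smul ha (by simp)).of_norm
    (mem_ball_zero_iff.2 hzr)
  rw [(hbound.of_norm_bounded fun n => hderiv_le n z (mem_ball_zero_iff.2 hzr)).tsum_eq_zero_add]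
    at hderiv
  simpa [mul_smul, smul_comm (z ^ _), ← Nat.cast_smul_eq_nsmul ℝ] using hderiv

end BoundedCoefficients

section UrnSeries

variable {𝕜 : Type*} [RCLike 𝕜] {w : Ball → 𝕜}

/-- The coefficient of `z ^ n` in the exponential generating function of the urn histories that
start with the ball `b`, weighted as in `urnWeightSum`. -/
def urnCoeff (w : Ball → 𝕜) (b : Ball) (n : ℕ) : 𝕜 := urnWeightSum w b n / n.factorial

theorem urnCoeff_zero (w : Ball → 𝕜) (b : Ball) : urnCoeff w b 0 = w b := by
  simp [urnCoeff, urnWeightSum_zero]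

theorem succ_nsmul_urnCoeff_succ (w : Ball → 𝕜) (b : Ball) (n : ℕ) :
    (n + 1) • urnCoeff w b (n + 1) =
      ∑ p ∈ antidiagonal n, urnCoeff w b.other p.1 * urnCoeff w b.other p.2 := by
  have hfact (m : ℕ) : (m.factorial : 𝕜) ≠ 0 := mod_cast m.factorial_ne_zero
  calc (n + 1) • urnCoeff w b (n + 1) = urnWeightSum w b (n + 1) / n.factorial := by
        have := hfact n
        have : (n : 𝕜) + 1 ≠ 0 := n.cast_add_one_ne_zero
        rw [urnCoeff, Nat.factorial_succ, nsmul_eq_mul]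
        push_cast
        field_simp
    _ = _ := by
        rw [urnWeightSum_succ, Finset.sum_div]
        refine Finset.sum_congr rfl fun p hp => ?_
        obtain rfl := Finset.HasAntidiagonal.mem_antidiagonal.1 hp
        have := hfact p.1
        have := hfact p.2
        have := hfact (p.1 + p.2)
        rw [urnCoeff, urnCoeff, nsmul_eq_mul, Nat.cast_add_choose]
        field_simp

theorem norm_urnCoeff_le (hw : ∀ b, ‖w b‖ ≤ 1) (b : Ball) (n : ℕ) : ‖urnCoeff w b n‖ ≤ 1 := by
  induction n using Nat.strong_induction_on generalizing b with
  | _ n ih =>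
    cases n with
    | zero => exact urnCoeff_zero w b ▸ hw b
    | succ n =>
      have hle : (n + 1) • ‖urnCoeff w b (n + 1)‖ ≤ (n + 1) • (1 : ℝ) := by
        rw [← RCLike.norm_nsmul 𝕜, succ_nsmul_urnCoeff_succ, ← Finset.Nat.card_antidiagonal n]
        refine (norm_sum_le _ _).trans (Finset.sum_le_card_nsmul _ _ _ fun p hp => ?_)
        have hp' := Finset.HasAntidiagonal.mem_antidiagonal.1 hp
        rw [norm_mul]
        exact mul_le_one₀ (ih _ (by omega) _) (norm_nonneg _) (ih _ (by omega) _)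
      exact le_of_nsmul_le_nsmul_right n.succ_ne_zero hle

/-- The exponential generating function of the urn histories that start with the ball `b`,
weighted as in `urnWeightSum`. -/
def urnSeries (w : Ball → 𝕜) (b : Ball) (z : ℝ) : 𝕜 := ∑' n, z ^ n • urnCoeff w b n

theorem urnSeries_zero (w : Ball → 𝕜) (b : Ball) : urnSeries w b 0 = w b := by
  rw [urnSeries, tsum_eq_single 0 fun n hn => by simp [hn]]
  simp [urnCoeff_zero]

theorem hasDerivAt_urnSeries (hw : ∀ b, ‖w b‖ ≤ 1) (b : Ball) {z : ℝ} (hz : |z| < 1) :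
    HasDerivAt (urnSeries w b) (urnSeries w b.other z ^ 2) z := by
  have hsummable := summable_norm_pow_smul (norm_urnCoeff_le hw b.other) hz
  have hsq : urnSeries w b.other z ^ 2 = ∑' n, z ^ n • ((n + 1) • urnCoeff w b (n + 1)) := by
    rw [sq, urnSeries, tsum_mul_tsum_eq_tsum_sum_antidiagonal_of_summable_norm hsummable hsummable]
    refine tsum_congr fun n => ?_
    rw [succ_nsmul_urnCoeff_succ, Finset.smul_sum]
    refine Finset.sum_congr rfl fun p hp => ?_
    rw [smul_mul_smul_comm, ← pow_add, Finset.HasAntidiagonal.mem_antidiagonal.1 hp]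
  rw [hsq]
  exact hasDerivAt_tsum_pow_smul (norm_urnCoeff_le hw b) hz

theorem urnSeries_cube_sub_cube (hw : ∀ b, ‖w b‖ ≤ 1) {z : ℝ} (hz : |z| < 1) :
    urnSeries w Ball.y z ^ 3 - urnSeries w Ball.x z ^ 3 = w Ball.y ^ 3 - w Ball.x ^ 3 := by
  have hderiv (u : ℝ) (hu : u ∈ Metric.ball 0 1) :
      HasDerivAt (fun u => urnSeries w Ball.y u ^ 3 - urnSeries w Ball.x u ^ 3) 0 u := by
    have hu' : |u| < 1 := mem_ball_zero_iff.1 hu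
    convert! ((hasDerivAt_urnSeries hw Ball.y hu').fun_pow 3).fun_sub
      ((hasDerivAt_urnSeries hw Ball.x hu').fun_pow 3) using 1
    simp only [Ball.other]
    ring
  simpa only [urnSeries_zero] using Metric.isOpen_ball.is_const_of_deriv_eq_zero
    (convex_ball 0 1).isPreconnected
    (fun u hu => (hderiv u hu).differentiableAt.differentiableWithinAt)
    (fun u hu => (hderiv u hu).deriv) (mem_ball_zero_iff.2 hz) (Metric.mem_ball_self one_pos)

theorem monotoneOn_urnSeries {w : Ball → ℝ} (hw : ∀ b, ‖w b‖ ≤ 1) (b : Ball) :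
    MonotoneOn (urnSeries w b) (Ioo (-1) 1) := by
  have hderiv (z : ℝ) (hz : z ∈ Ioo (-1) 1) := hasDerivAt_urnSeries hw b (abs_lt.2 hz)
  refine monotoneOn_of_deriv_nonneg (convex_Ioo (-1) 1) (HasDerivAt.continuousOn hderiv) ?_ ?_ <;>
    rw [interior_Ioo]
  · exact fun z hz => (hderiv z hz).differentiableAt.differentiableWithinAt
  · exact fun z hz => (hderiv z hz).deriv ▸ sq_nonneg _

theorem norm_mulSingle_le_one {x : 𝕜} (hx : ‖x‖ ≤ 1) (b : Ball) :
    ‖(Pi.mulSingle Ball.x x : Ball → 𝕜) b‖ ≤ 1 := by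
  cases b <;> simp [hx]

theorem hasSum_urnCount_mul_pow_div (x : 𝕜) (z : ℝ) (n : ℕ) :
    HasSum (fun k => (urnCount n k : 𝕜) * x ^ k * (z : 𝕜) ^ n / n.factorial)
      (z ^ n • urnCoeff (Pi.mulSingle Ball.x x) Ball.x n) := by
  have hsum := ((hasSum_urnCount x n).mul_right ((z : 𝕜) ^ n)).div_const (n.factorial : 𝕜)
  rwa [mul_div_right_comm, mul_comm, ← RCLike.ofReal_pow, ← RCLike.real_smul_eq_coe_mul,
    RCLike.ofReal_pow, ← urnCoeff] at hsum

theorem summable_urnCount_prod {x : 𝕜} (hx : ‖x‖ ≤ 1) {z : ℝ} (hz : |z| < 1) :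
    Summable fun p : ℕ × ℕ =>
      (urnCount p.1 p.2 : 𝕜) * x ^ p.2 * (z : 𝕜) ^ p.1 / p.1.factorial := by
  have hfiber (n : ℕ) :
      HasSum (fun k => (urnCount n k : ℝ) * ‖x‖ ^ k * |z| ^ n / n.factorial)
        (|z| ^ n • urnCoeff (Pi.mulSingle Ball.x ‖x‖) Ball.x n) :=
    hasSum_urnCount_mul_pow_div ‖x‖ |z| n
  have hnorm : Summable fun p : ℕ × ℕ =>
      (urnCount p.1 p.2 : ℝ) * ‖x‖ ^ p.2 * |z| ^ p.1 / p.1.factorial := by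
    refine (summable_prod_of_nonneg fun p => by positivity).2 ⟨fun n => (hfiber n).summable, ?_⟩
    simp_rw [fun n => (hfiber n).tsum_eq]
    exact (summable_norm_pow_smul (norm_urnCoeff_le
      (norm_mulSingle_le_one ((norm_norm x).trans_le hx)) Ball.x) (by rwa [abs_abs])).of_norm
  exact .of_norm (by simpa using hnorm)

theorem hasSum_urnCount_prod {x : 𝕜} (hx : ‖x‖ ≤ 1) {z : ℝ} (hz : |z| < 1) :
    HasSum (fun p : ℕ × ℕ =>
      (urnCount p.1 p.2 : 𝕜) * x ^ p.2 * (z : 𝕜) ^ p.1 / p.1.factorial)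
      (urnSeries (Pi.mulSingle Ball.x x) Ball.x z) := by
  have hsum := (summable_urnCount_prod hx hz).hasSum
  rwa [urnSeries, (hsum.prod_fiberwise (hasSum_urnCount_mul_pow_div x z)).tsum_eq]

end UrnSeries

/-! ### The closed form -/

theorem one_add_cube_pos_iff {u : ℝ} : 0 < 1 + u ^ 3 ↔ -1 < u := by
  rw [← (show Odd 3 by decide).strictMono_pow.lt_iff_lt (a := -1)]
  norm_num [neg_lt_iff_pos_add']

/-- The Abelian integral whose inverse is `dixonSmh`. -/
def dixonArcsmh (u : ℝ) : ℝ := ∫ s in (0 : ℝ)..u, 1 / (1 + s ^ 3) ^ (2 / 3 : ℝ)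

theorem dixonArcsmh_zero : dixonArcsmh 0 = 0 := intervalIntegral.integral_same

theorem hasStrictDerivAt_dixonArcsmh {u : ℝ} (hu : -1 < u) :
    HasStrictDerivAt dixonArcsmh (1 / (1 + u ^ 3) ^ (2 / 3 : ℝ)) u := by
  have hcont : ContinuousOn (fun s : ℝ => 1 / (1 + s ^ 3) ^ (2 / 3 : ℝ)) (Ioi (-1)) := by
    have hpos (s : ℝ) (hs : s ∈ Ioi (-1)) : 0 < 1 + s ^ 3 := one_add_cube_pos_iff.2 hs
    exact continuousOn_const.div
      (ContinuousOn.rpow_const (by fun_prop) fun s hs => .inl (hpos s hs).ne')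
      fun s hs => (Real.rpow_pos_of_pos (hpos s hs) _).ne'
  have hsub : uIcc 0 u ⊆ Ioi (-1) := fun s hs => (lt_min (by norm_num) hu).trans_le hs.1
  exact intervalIntegral.integral_hasStrictDerivAt_right (hcont.mono hsub).intervalIntegrable
    (hcont.stronglyMeasurableAtFilter isOpen_Ioi u hu) (hcont.continuousAt (Ioi_mem_nhds hu))

theorem continuousOn_dixonArcsmh : ContinuousOn dixonArcsmh (Ioi (-1)) :=
  HasDerivAt.continuousOn fun _ hu => (hasStrictDerivAt_dixonArcsmh hu).hasDerivAt

theorem strictMonoOn_dixonArcsmh : StrictMonoOn dixonArcsmh (Ioi (-1)) := by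
  refine strictMonoOn_of_deriv_pos (convex_Ioi _) continuousOn_dixonArcsmh fun u hu => ?_
  rw [interior_Ioi] at hu
  rw [(hasStrictDerivAt_dixonArcsmh hu).hasDerivAt.deriv]
  exact one_div_pos.2 (Real.rpow_pos_of_pos (one_add_cube_pos_iff.2 hu) _)

/-- The inverse of `dixonArcsmh` on the image of `(-1, ∞)`. -/
def dixonArcsmhInv : ℝ → ℝ := Function.invFunOn dixonArcsmh (Ioi (-1))

theorem dixonArcsmhInv_dixonArcsmh {u : ℝ} (hu : -1 < u) :
    dixonArcsmhInv (dixonArcsmh u) = u :=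
  strictMonoOn_dixonArcsmh.injOn.leftInvOn_invFunOn hu

theorem hasDerivAt_dixonArcsmhInv {u : ℝ} (hu : -1 < u) :
    HasDerivAt dixonArcsmhInv ((1 + u ^ 3) ^ (2 / 3 : ℝ)) (dixonArcsmh u) := by
  have hpos := Real.rpow_pos_of_pos (one_add_cube_pos_iff.2 hu) (2 / 3)
  have hleft : ∀ᶠ v in nhds u, dixonArcsmhInv (dixonArcsmh v) = v := by
    filter_upwards [Ioi_mem_nhds hu] with v hv using dixonArcsmhInv_dixonArcsmh hv
  simpa using ((hasStrictDerivAt_dixonArcsmh hu).to_local_left_inverse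
    (one_div_pos.2 hpos).ne' hleft).hasDerivAt

theorem hasDerivAt_one_add_dixonArcsmhInv_cube_rpow {u : ℝ} (hu : -1 < u) :
    HasDerivAt (fun w => (1 + dixonArcsmhInv w ^ 3) ^ (1 / 3 : ℝ)) (u ^ 2) (dixonArcsmh u) := by
  have hpos : 0 < 1 + u ^ 3 := one_add_cube_pos_iff.2 hu
  have hinv := dixonArcsmhInv_dixonArcsmh hu
  have hderiv := (((hasDerivAt_dixonArcsmhInv hu).fun_pow 3).const_add 1).rpow_const
    (p := 1 / 3) (.inl (by rw [hinv]; exact hpos.ne'))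
  rw [hinv] at hderiv
  convert! hderiv using 1
  have hrpow : (1 + u ^ 3) ^ (2 / 3 : ℝ) * (1 + u ^ 3) ^ (1 / 3 - 1 : ℝ) = 1 := by
    rw [← Real.rpow_add hpos]
    norm_num
  push_cast
  linear_combination -u ^ 2 * hrpow

theorem isDixonSolution_dixonArcsmhInv {p q : ℝ} (hp : -1 < p) (hp0 : p < 0) (hq0 : 0 < q) :
    IsDixonSolution (-dixonArcsmh q) (-dixonArcsmh p) (fun z => -dixonArcsmhInv (-z))
      (fun z => (1 + dixonArcsmhInv (-z) ^ 3) ^ (1 / 3 : ℝ)) := by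
  have hinv_zero : dixonArcsmhInv 0 = 0 := by
    simpa only [dixonArcsmh_zero] using dixonArcsmhInv_dixonArcsmh (neg_one_lt_zero (R := ℝ))
  have hsurj (z : ℝ) (hz : z ∈ Ioo (-dixonArcsmh q) (-dixonArcsmh p)) :
      ∃ u, -1 < u ∧ dixonArcsmh u = -z := by
    obtain ⟨u, hu, huz⟩ := intermediate_value_Ioo (hp0.trans hq0).le
      (continuousOn_dixonArcsmh.mono fun u hu => hp.trans_le hu.1)
      (show -z ∈ Ioo (dixonArcsmh p) (dixonArcsmh q) from ⟨lt_neg.1 hz.2, neg_lt.1 hz.1⟩)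
    exact ⟨u, hp.trans hu.1, huz⟩
  refine ⟨?_, ?_, by simp [hinv_zero], by simp [hinv_zero], fun z hz => ?_, fun z hz => ?_⟩
  · simpa [dixonArcsmh_zero] using
      strictMonoOn_dixonArcsmh (neg_one_lt_zero (R := ℝ)) (neg_one_lt_zero.trans hq0) hq0
  · simpa [dixonArcsmh_zero] using
      strictMonoOn_dixonArcsmh hp (neg_one_lt_zero (R := ℝ)) hp0
  · obtain ⟨u, hu, huz⟩ := hsurj z hz
    have hderiv := ((huz ▸ hasDerivAt_dixonArcsmhInv hu).scomp z (hasDerivAt_neg z)).fun_neg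
    convert! hderiv using 1
    rw [← huz, dixonArcsmhInv_dixonArcsmh hu, ← Real.rpow_natCast,
      ← Real.rpow_mul (one_add_cube_pos_iff.2 hu).le]
    norm_num
  · obtain ⟨u, hu, huz⟩ := hsurj z hz
    have hderiv := (huz ▸ hasDerivAt_one_add_dixonArcsmhInv_cube_rpow hu).scomp z (hasDerivAt_neg z)
    convert! hderiv using 1
    simp [← huz, dixonArcsmhInv_dixonArcsmh hu]

theorem dixonSmh_dixonArcsmh {u : ℝ} (hu : -1 < u) : dixonSmh (dixonArcsmh u) = u := by
  obtain ⟨p, hp, hpu⟩ := exists_between (lt_min hu neg_one_lt_zero)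
  obtain ⟨q, hqu⟩ := exists_gt (max u 0)
  obtain ⟨hpu, hp0⟩ := lt_min_iff.1 hpu
  obtain ⟨huq, hq0⟩ := max_lt_iff.1 hqu
  have hmem : -dixonArcsmh u ∈ Ioo (-dixonArcsmh q) (-dixonArcsmh p) :=
    ⟨neg_lt_neg (strictMonoOn_dixonArcsmh hu (hu.trans huq) huq),
      neg_lt_neg (strictMonoOn_dixonArcsmh hp hu hpu)⟩
  rw [dixonSmh, (isDixonSolution_dixonArcsmhInv hp hp0 hq0).dixonSm_eq hmem, neg_neg, neg_neg,
    dixonArcsmhInv_dixonArcsmh hu]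

section ClosedForm

variable {w : Ball → ℝ} {m z : ℝ}

theorem one_add_urnSeries_div_cube (hw : ∀ b, ‖w b‖ ≤ 1) (hm : m ≠ 0)
    (hm3 : m ^ 3 = w Ball.y ^ 3 - w Ball.x ^ 3) (hz : |z| < 1) :
    1 + (urnSeries w Ball.x z / m) ^ 3 = (urnSeries w Ball.y z / m) ^ 3 := by
  have hcube := urnSeries_cube_sub_cube hw hz
  field_simp
  linear_combination hm3 - hcube

theorem urnSeries_y_pos (hw : ∀ b, ‖w b‖ ≤ 1) (hy : 0 < w Ball.y) (hz : z ∈ Ico 0 1) :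
    0 < urnSeries w Ball.y z := by
  refine (urnSeries_zero w Ball.y ▸ hy).trans_le
    (monotoneOn_urnSeries hw Ball.y ⟨?_, one_pos⟩ ⟨?_, hz.2⟩ hz.1) <;> linarith [hz.1]

theorem neg_one_lt_urnSeries_x_div (hw : ∀ b, ‖w b‖ ≤ 1) (hy : 0 < w Ball.y) (hm : 0 < m)
    (hm3 : m ^ 3 = w Ball.y ^ 3 - w Ball.x ^ 3) (hz : z ∈ Ico 0 1) :
    -1 < urnSeries w Ball.x z / m := by
  rw [← one_add_cube_pos_iff,
    one_add_urnSeries_div_cube hw hm.ne' hm3 ((abs_of_nonneg hz.1).trans_lt hz.2)]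
  exact pow_pos (div_pos (urnSeries_y_pos hw hy hz) hm) 3

theorem hasDerivAt_dixonArcsmh_urnSeries_div (hw : ∀ b, ‖w b‖ ≤ 1) (hy : 0 < w Ball.y)
    (hm : 0 < m) (hm3 : m ^ 3 = w Ball.y ^ 3 - w Ball.x ^ 3) (hz : z ∈ Ico 0 1) :
    HasDerivAt (fun z => dixonArcsmh (urnSeries w Ball.x z / m)) m z := by
  have hY := urnSeries_y_pos hw hy hz
  have hz' : |z| < 1 := (abs_of_nonneg hz.1).trans_lt hz.2
  refine ((hasStrictDerivAt_dixonArcsmh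
    (neg_one_lt_urnSeries_x_div hw hy hm hm3 hz)).hasDerivAt.scomp z
      ((hasDerivAt_urnSeries hw Ball.x hz').div_const m)).congr_deriv ?_
  have hrpow : (1 + (urnSeries w Ball.x z / m) ^ 3) ^ (2 / 3 : ℝ) =
      (urnSeries w Ball.y z / m) ^ 2 := by
    rw [one_add_urnSeries_div_cube hw hm.ne' hm3 hz', ← Real.rpow_natCast _ 3,
      ← Real.rpow_mul (by positivity)]
    norm_num
  rw [hrpow, Ball.other, smul_eq_mul]
  field_simp

theorem dixonArcsmh_urnSeries_div (hw : ∀ b, ‖w b‖ ≤ 1) (hy : 0 < w Ball.y)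
    (hm : 0 < m) (hm3 : m ^ 3 = w Ball.y ^ 3 - w Ball.x ^ 3) (hz : z ∈ Ico 0 1) :
    dixonArcsmh (urnSeries w Ball.x z / m) = m * z + dixonArcsmh (w Ball.x / m) := by
  have hderiv (u : ℝ) (hu : u ∈ Icc 0 z) :
      HasDerivAt (fun u => dixonArcsmh (urnSeries w Ball.x u / m) - m * u) 0 u := by
    simpa using (hasDerivAt_dixonArcsmh_urnSeries_div hw hy hm hm3
      ⟨hu.1, hu.2.trans_lt hz.2⟩).fun_sub ((hasDerivAt_id u).const_mul m)
  have hconst := constant_of_has_deriv_right_zero (HasDerivAt.continuousOn hderiv)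
    (fun u hu => (hderiv u (Ico_subset_Icc_self hu)).hasDerivWithinAt) z (right_mem_Icc.2 hz.1)
  rw [urnSeries_zero] at hconst
  linarith

theorem urnSeries_x_eq_mul_dixonSmh (hw : ∀ b, ‖w b‖ ≤ 1) (hy : 0 < w Ball.y)
    (hm : 0 < m) (hm3 : m ^ 3 = w Ball.y ^ 3 - w Ball.x ^ 3) (hz : z ∈ Ico 0 1) :
    urnSeries w Ball.x z = m * dixonSmh (m * z + dixonArcsmh (w Ball.x / m)) := by
  rw [← dixonArcsmh_urnSeries_div hw hy hm hm3 hz,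
    dixonSmh_dixonArcsmh (neg_one_lt_urnSeries_x_div hw hy hm hm3 hz), mul_div_cancel₀ _ hm.ne']

theorem urnClosedForm_eq_urnSeries {x : ℝ} (hx : x ∈ Ico (-1) 1) (hz : z ∈ Ico 0 1) :
    urnClosedForm x z = urnSeries (Pi.mulSingle Ball.x x) Ball.x z := by
  have hx3 : 0 < 1 - x ^ 3 := by
    rw [sub_eq_add_neg, ← (show Odd 3 by decide).neg_pow, one_add_cube_pos_iff]
    exact neg_lt_neg hx.2
  have hm3 : ((1 - x ^ 3) ^ (1 / 3 : ℝ)) ^ 3 =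
      (Pi.mulSingle Ball.x x : Ball → ℝ) Ball.y ^ 3 -
        (Pi.mulSingle Ball.x x : Ball → ℝ) Ball.x ^ 3 := by
    rw [← Real.rpow_natCast, ← Real.rpow_mul hx3.le]
    simp
  rw [urnSeries_x_eq_mul_dixonSmh (norm_mulSingle_le_one (abs_le.2 ⟨hx.1, hx.2.le⟩)) (by simp)
    (Real.rpow_pos_of_pos hx3 _) hm3 hz, urnClosedForm, dixonArcsmh, Real.rpow_neg hx3.le,
    ← div_eq_mul_inv, Pi.mulSingle_eq_same]

end ClosedForm

/-! ### The branching property of the particle counts -/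

theorem Particle.type_concat (v : Particle) (b : Bool) :
    Particle.type (v ++ [b]) = (Particle.type v).other := by
  induction v with
  | nil => rfl
  | cons _ v ih => exact congrArg Ball.other ih

theorem Particle.concat_injective (b : Bool) : Function.Injective fun v : Particle => v ++ [b] :=
  fun _ _ h => List.append_cancel_right h

/-- The lifetimes of the descendants of the offspring `b` of the initial particle. The line of
descent is read from right to left, so these are the particles whose name ends in `b`. -/
def subtreeLifetimes (T : Particle → ℝ) (b : Bool) : Particle → ℝ := fun v => T (v ++ [b])

theorem birthTime_concat (T : Particle → ℝ) (v : Particle) (b : Bool) :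
    birthTime T (v ++ [b]) = T [] + birthTime (subtreeLifetimes T b) v := by
  induction v with
  | nil => simp [birthTime]
  | cons _ v ih => simp only [List.cons_append, birthTime, ih, subtreeLifetimes, add_assoc]

theorem birthTime_nonneg {T : Particle → ℝ} (hT : ∀ v, 0 ≤ T v) (v : Particle) :
    0 ≤ birthTime T v := by
  induction v with
  | nil => exact le_rfl
  | cons _ v ih => exact add_nonneg ih (hT v)

theorem le_birthTime_concat {T : Particle → ℝ} (hT : ∀ v, 0 ≤ T v) (v : Particle) (b : Bool) :
    T [] ≤ birthTime T (v ++ [b]) := by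
  rw [birthTime_concat]
  exact le_add_of_nonneg_right (birthTime_nonneg (fun u => hT (u ++ [b])) v)

theorem aliveAt_of_lt {T : Particle → ℝ} {t : ℝ} (hT : ∀ v, 0 ≤ T v) (ht : 0 ≤ t) (h : t < T []) :
    aliveAt T t = {[]} := by
  ext v
  rcases List.eq_nil_or_concat' v with rfl | ⟨u, b, rfl⟩
  · simp [aliveAt, birthTime, ht, h]
  · simp [aliveAt, (h.trans_le (le_birthTime_concat hT u b)).not_ge]

theorem concat_mem_aliveAt {T : Particle → ℝ} {t : ℝ} {v : Particle} {b : Bool} :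
    v ++ [b] ∈ aliveAt T t ↔ v ∈ aliveAt (subtreeLifetimes T b) (t - T []) := by
  change birthTime T (v ++ [b]) ≤ t ∧ t < birthTime T (v ++ [b]) + subtreeLifetimes T b v ↔ _
  rw [birthTime_concat, add_assoc, ← le_sub_iff_add_le', ← sub_lt_iff_lt_add']
  rfl

/-- The number of particles of type `c` that are present at time `t`, given the lifetimes `T` and
with an initial particle of type `x`; for `c = x` this is `yuleCount`. -/
def typeCount (c : Ball) (T : Particle → ℝ) (t : ℝ) : ℕ∞ :=
  {v ∈ aliveAt T t | Particle.type v = c}.encard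

theorem typeCount_of_lt {T : Particle → ℝ} {t : ℝ} (hT : ∀ v, 0 ≤ T v) (ht : 0 ≤ t) (h : t < T [])
    (c : Ball) : typeCount c T t = if c = Ball.x then 1 else 0 := by
  rw [typeCount, aliveAt_of_lt hT ht h]
  cases c
  · exact encard_eq_one.2 ⟨[], ext fun v => and_iff_left_of_imp fun hv => by rw [hv, Particle.type]⟩
  · refine encard_eq_zero.2 (eq_empty_of_forall_notMem ?_)
    rintro _ ⟨rfl, htype⟩
    cases htype

theorem typeCount_of_le {T : Particle → ℝ} {t : ℝ} (h : T [] ≤ t) (c : Ball) :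
    typeCount c T t = typeCount c.other (subtreeLifetimes T false) (t - T []) +
      typeCount c.other (subtreeLifetimes T true) (t - T []) := by
  have hsplit : {v ∈ aliveAt T t | Particle.type v = c} =
      (· ++ [false]) ''
          {v ∈ aliveAt (subtreeLifetimes T false) (t - T []) | Particle.type v = c.other} ∪
        (· ++ [true]) ''
          {v ∈ aliveAt (subtreeLifetimes T true) (t - T []) | Particle.type v = c.other} := by
    ext v
    rcases List.eq_nil_or_concat' v with rfl | ⟨u, b, rfl⟩
    · simp [aliveAt, birthTime, h]
    · cases b <;> simp [concat_mem_aliveAt, Particle.type_concat, Ball.other_eq_iff]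
  have hdisj (s s' : Set Particle) : Disjoint ((· ++ [false]) '' s) ((· ++ [true]) '' s') := by
    rw [Set.disjoint_left]
    rintro _ ⟨u, -, rfl⟩ ⟨v, -, huv⟩
    simp at huv
  rw [typeCount, hsplit, encard_union_eq (hdisj _ _),
    (Particle.concat_injective false).encard_image, (Particle.concat_injective true).encard_image]
  rfl

theorem measurable_birthTime (v : Particle) : Measurable fun T : Particle → ℝ => birthTime T v := by
  induction v with
  | nil => exact measurable_const
  | cons _ v ih => exact ih.add (measurable_pi_apply v)

theorem measurable_typeCount (c : Ball) :
    Measurable fun p : (Particle → ℝ) × ℝ => typeCount c p.1 p.2 := by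
  refine measurable_encard.comp (measurable_set_iff.2 fun v => measurableSet_setOfPred.1 ?_)
  have hbirth : Measurable fun p : (Particle → ℝ) × ℝ => birthTime p.1 v :=
    (measurable_birthTime v).comp measurable_fst
  have hlife : Measurable fun p : (Particle → ℝ) × ℝ => p.1 v :=
    (measurable_pi_apply v).comp measurable_fst
  exact ((measurableSet_le hbirth measurable_snd).inter
    (measurableSet_lt measurable_snd (hbirth.add hlife))).inter (MeasurableSet.const _)

/-! ### The law of the lifetimes -/

section LifetimeLaw

theorem comap_precomp_pi {Ω ι γ : Type*} {𝓧 : ι → Type*} [∀ i, MeasurableSpace (𝓧 i)]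
    (X : (i : ι) → Ω → 𝓧 i) (k : γ → ι) :
    MeasurableSpace.comap (fun ω c => X (k c) ω) MeasurableSpace.pi =
      ⨆ i ∈ range k, MeasurableSpace.comap (X i) inferInstance := by
  simp only [MeasurableSpace.pi, MeasurableSpace.comap_iSup, MeasurableSpace.comap_comp, iSup_range]
  rfl

variable {Ω : Type*} [MeasurableSpace Ω] {μ : Measure Ω}

theorem indepFun_precomp_of_disjoint_range {ι α β : Type*} {𝓧 : ι → Type*}
    [∀ i, MeasurableSpace (𝓧 i)] {X : (i : ι) → Ω → 𝓧 i} (hX : iIndepFun X μ)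
    (hXm : ∀ i, Measurable (X i)) {f : α → ι} {g : β → ι} (hfg : Disjoint (range f) (range g)) :
    IndepFun (fun ω a => X (f a) ω) (fun ω b => X (g b) ω) μ := by
  rw [IndepFun_iff_Indep, comap_precomp_pi, comap_precomp_pi]
  exact indep_iSup_of_disjoint (fun i => (hXm i).comap_le) hX hfg

theorem integral_expMeasure {E : Type*} [NormedAddCommGroup E] [NormedSpace ℝ E] {r : ℝ}
    (hr : 0 ≤ r) (f : ℝ → E) :
    ∫ s, f s ∂expMeasure r = ∫ s in Ioi 0, (r * Real.exp (-(r * s))) • f s := by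
  have hdensity : expMeasure r =
    volume.withDensity fun s => ENNReal.ofReal (exponentialPDFReal r s) := rfl
  rw [hdensity, integral_withDensity_eq_integral_toReal_smul
    (measurable_exponentialPDFReal r).ennreal_ofReal (by simp),
    ← integral_Ici_eq_integral_Ioi, ← integral_indicator measurableSet_Ici]
  refine integral_congr_ae (.of_forall fun s => ?_)
  change (exponentialPDF r s).toReal • f s = _
  by_cases hs : 0 ≤ s
  · simp [exponentialPDF_of_nonneg hs, hs, mul_nonneg hr (Real.exp_pos _).le]
  · simp [exponentialPDF_of_neg (not_le.1 hs), hs]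

theorem ae_expMeasure_nonneg (r : ℝ) : ∀ᵐ s ∂expMeasure r, 0 ≤ s := by
  have hdensity : expMeasure r =
    volume.withDensity fun s => ENNReal.ofReal (exponentialPDFReal r s) := rfl
  rw [hdensity, ae_withDensity_iff (measurable_exponentialPDFReal r).ennreal_ofReal]
  refine .of_forall fun s hs => ?_
  by_contra! hneg
  exact hs (exponentialPDF_of_neg hneg)

instance : IsProbabilityMeasure (expMeasure 1) := isProbabilityMeasure_expMeasure one_pos

/-- The joint law of independent lifetimes that are exponential of rate `1`. -/
def lifetimeLaw : Measure (Particle → ℝ) := Measure.infinitePi fun _ => expMeasure 1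

instance : IsProbabilityMeasure lifetimeLaw :=
  inferInstanceAs (IsProbabilityMeasure (Measure.infinitePi _))

theorem IsYuleLifetimes.hasLaw_lifetimeLaw {T : Particle → Ω → ℝ} (hT : IsYuleLifetimes μ T) :
    HasLaw (fun ω v => T v ω) lifetimeLaw μ :=
  hT.indep.hasLaw_infinitePi hT.hasLaw (aemeasurable_pi_iff.2 fun v => (hT.hasLaw v).aemeasurable)

theorem ae_lifetimeLaw_nonneg : ∀ᵐ T ∂lifetimeLaw, ∀ v, 0 ≤ T v :=
  ae_all_iff.2 fun v => (measurePreserving_eval_infinitePi (fun _ : Particle => expMeasure 1)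
    v).quasiMeasurePreserving.ae (ae_expMeasure_nonneg 1)

theorem measurable_subtreeLifetimes (b : Bool) :
    Measurable fun T : Particle → ℝ => subtreeLifetimes T b :=
  measurable_pi_lambda _ fun v => measurable_pi_apply (v ++ [b])

theorem map_subtreeLifetimes_lifetimeLaw (b : Bool) :
    lifetimeLaw.map (fun T => subtreeLifetimes T b) = lifetimeLaw :=
  Measure.map_infinitePi_infinitePi_of_inj (Particle.concat_injective b)

theorem indepFun_subtreeLifetimes :
    IndepFun (fun T => subtreeLifetimes T false) (fun T => subtreeLifetimes T true)
      lifetimeLaw := by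
  refine indepFun_precomp_of_disjoint_range (X := fun v (T : Particle → ℝ) => T v)
    (f := (· ++ [false])) (g := (· ++ [true]))
    (iIndepFun_infinitePi (X := fun _ ω => ω) fun _ => measurable_id) measurable_pi_apply ?_
  rw [Set.disjoint_left]
  rintro _ ⟨u, rfl⟩ ⟨v, huv⟩
  simp at huv

theorem indepFun_root_subtreeLifetimes :
    IndepFun (fun T => T []) (fun T => (subtreeLifetimes T false, subtreeLifetimes T true))
      lifetimeLaw := by
  have h : IndepFun (fun (T : Particle → ℝ) (_ : Unit) => T [])
      (fun T (p : Bool × Particle) => T (p.2 ++ [p.1])) lifetimeLaw := by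
    refine indepFun_precomp_of_disjoint_range (X := fun v (T : Particle → ℝ) => T v)
      (f := fun _ => []) (g := fun p : Bool × Particle => p.2 ++ [p.1])
      (iIndepFun_infinitePi (X := fun _ ω => ω) fun _ => measurable_id) measurable_pi_apply ?_
    rw [Set.disjoint_left]
    rintro _ ⟨_, rfl⟩ ⟨p, hp⟩
    simp at hp
  exact h.comp (φ := fun s : Unit → ℝ => s ())
    (ψ := fun S : Bool × Particle → ℝ => (fun v => S (false, v), fun v => S (true, v)))
    (by fun_prop) (by fun_prop)

theorem map_root_subtreeLifetimes_lifetimeLaw :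
    lifetimeLaw.map (fun T => (T [], subtreeLifetimes T false, subtreeLifetimes T true)) =
      (expMeasure 1).prod (lifetimeLaw.prod lifetimeLaw) := by
  have hsub (b : Bool) := (measurable_subtreeLifetimes b).aemeasurable (μ := lifetimeLaw)
  rw [indepFun_root_subtreeLifetimes.map_prod_eq_prod_map_map
      (measurable_pi_apply _).aemeasurable ((hsub false).prodMk (hsub true)),
    indepFun_subtreeLifetimes.map_prod_eq_prod_map_map (hsub false) (hsub true),
    map_subtreeLifetimes_lifetimeLaw, map_subtreeLifetimes_lifetimeLaw]
  exact congrArg (Measure.prod · _) (Measure.infinitePi_map_eval _ [])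

end LifetimeLaw

/-! ### Probability generating functions -/

/-- The power `x ^ n` with an exponent in `ℕ∞`, with the convention `x ^ ∞ = 0`, so that
`∑ k, P(N = k) x ^ k` is the expectation of `enatPow x N`, also on the boundary of the unit disc. -/
def enatPow {M : Type*} [MonoidWithZero M] (x : M) (n : ℕ∞) : M := if n = ⊤ then 0 else x ^ n.toNat

section MonoidWithZero

variable {M : Type*} [MonoidWithZero M]

theorem enatPow_natCast (x : M) (n : ℕ) : enatPow x (n : ℕ∞) = x ^ n := by
  simp [enatPow]

theorem enatPow_top (x : M) : enatPow x ⊤ = 0 := by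
  simp [enatPow]

theorem enatPow_add (x : M) (m n : ℕ∞) : enatPow x (m + n) = enatPow x m * enatPow x n := by
  induction m using ENat.recTopCoe with
  | top => simp [enatPow_top]
  | coe m =>
    induction n using ENat.recTopCoe with
    | top => simp [enatPow_top]
    | coe n => simp only [← Nat.cast_add, enatPow_natCast, pow_add]

theorem enatPow_ite_one_zero (x : M) (c : Ball) :
    enatPow x (if c = Ball.x then 1 else 0) = (Pi.mulSingle Ball.x x : Ball → M) c := by
  cases c
  · simpa using enatPow_natCast x 1
  · simpa using enatPow_natCast x 0

end MonoidWithZero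

theorem norm_enatPow_le_one {R : Type*} [SeminormedRing R] [NormOneClass R] {x : R} (hx : ‖x‖ ≤ 1)
    (n : ℕ∞) : ‖enatPow x n‖ ≤ 1 := by
  induction n using ENat.recTopCoe with
  | top => simp [enatPow_top]
  | coe n => exact enatPow_natCast x n ▸ (norm_pow_le x n).trans (pow_le_one₀ (norm_nonneg x) hx)

theorem hasSum_measureReal_mul_pow {𝕜 Ω : Type*} [RCLike 𝕜] [MeasurableSpace Ω] {μ : Measure Ω}
    [IsFiniteMeasure μ] {N : Ω → ℕ∞} (hN : AEMeasurable N μ) {x : 𝕜} (hx : ‖x‖ ≤ 1) :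
    HasSum (fun k : ℕ => (μ.real {ω | N ω = k} : 𝕜) * x ^ k) (∫ ω, enatPow x (N ω) ∂μ) := by
  have hmeas (k : ℕ) : NullMeasurableSet {ω | N ω = k} μ :=
    hN.nullMeasurable (measurableSet_singleton (k : ℕ∞))
  have hdisj : Pairwise (Function.onFun (AEDisjoint μ) fun k : ℕ => {ω | N ω = k}) :=
    fun i j hij => (Set.disjoint_left.2 fun ω hi hj =>
      hij (Nat.cast_injective (hi.symm.trans hj))).aedisjoint
  have hint : Integrable (fun ω => enatPow x (N ω)) μ :=
    .of_bound ((measurable_of_countable (enatPow x)).comp_aemeasurable hN).aestronglyMeasurable 1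
      (.of_forall fun ω => norm_enatPow_le_one hx _)
  have hsum := hasSum_integral_iUnion_ae hmeas hdisj hint.integrableOn
  rw [setIntegral_eq_integral_of_forall_compl_eq_zero fun ω hω => ?_] at hsum
  · refine hsum.congr_fun fun k => ?_
    rw [setIntegral_congr_fun₀ (hmeas k) (g := fun _ => x ^ k) fun ω hω => ?_, setIntegral_const,
      RCLike.real_smul_eq_coe_mul]
    have hωk : N ω = k := hω
    simp only [hωk, enatPow_natCast]
  · have htop : N ω = ⊤ := by
      by_contra h
      obtain ⟨k, hk⟩ := ENat.ne_top_iff_exists.1 h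
      exact hω (mem_iUnion.2 ⟨k, hk.symm⟩)
    rw [htop, enatPow_top]

section TypePGF

variable {𝕜 : Type*} [RCLike 𝕜] {x : 𝕜}

/-- The probability generating function, evaluated at `x`, of the number of particles of type `c`
present at time `t`, when the initial particle has type `x`. Exchanging the two types, it is also
that of the number of particles of type `x` when the initial particle has type `c`. -/
def typePGF (x : 𝕜) (c : Ball) (t : ℝ) : 𝕜 := ∫ T, enatPow x (typeCount c T t) ∂lifetimeLaw

theorem measurable_enatPow_typeCount (x : 𝕜) (c : Ball) :
    Measurable fun p : (Particle → ℝ) × ℝ => enatPow x (typeCount c p.1 p.2) :=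
  (measurable_of_countable (enatPow x)).comp (measurable_typeCount c)

theorem norm_typePGF_le_one (hx : ‖x‖ ≤ 1) (c : Ball) (t : ℝ) : ‖typePGF x c t‖ ≤ 1 := by
  simpa [typePGF] using norm_integral_le_of_norm_le_const (μ := lifetimeLaw)
    (.of_forall fun T => norm_enatPow_le_one hx (typeCount c T t))

theorem stronglyMeasurable_typePGF (x : 𝕜) (c : Ball) : StronglyMeasurable (typePGF x c) :=
  (measurable_enatPow_typeCount x c).stronglyMeasurable.integral_prod_left'

theorem intervalIntegrable_typePGF_sq (hx : ‖x‖ ≤ 1) (c : Ball) (a b : ℝ) :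
    IntervalIntegrable (fun s => typePGF x c s ^ 2) volume a b :=
  intervalIntegrable_const.mono_fun (f := fun _ => (1 : ℝ))
    ((stronglyMeasurable_typePGF x c).pow 2).aestronglyMeasurable (.of_forall fun s => by
      simpa using norm_typePGF_le_one hx c s)

theorem enatPow_typeCount (x : 𝕜) (c : Ball) {T : Particle → ℝ} {t : ℝ} (hT : ∀ v, 0 ≤ T v)
    (ht : 0 ≤ t) :
    enatPow x (typeCount c T t) = if t < T [] then (Pi.mulSingle Ball.x x : Ball → 𝕜) c else
      enatPow x (typeCount c.other (subtreeLifetimes T false) (t - T [])) *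
        enatPow x (typeCount c.other (subtreeLifetimes T true) (t - T [])) := by
  split_ifs with h
  · rw [typeCount_of_lt hT ht h, enatPow_ite_one_zero]
  · rw [typeCount_of_le (not_lt.1 h), enatPow_add]

theorem typePGF_eq_integral_expMeasure (hx : ‖x‖ ≤ 1) (c : Ball) {t : ℝ} (ht : 0 ≤ t) :
    typePGF x c t = ∫ s, (if t < s then (Pi.mulSingle Ball.x x : Ball → 𝕜) c else
      typePGF x c.other (t - s) ^ 2) ∂expMeasure 1 := by
  set F : ℝ × (Particle → ℝ) × (Particle → ℝ) → 𝕜 := fun p =>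
    if t < p.1 then (Pi.mulSingle Ball.x x : Ball → 𝕜) c else
      enatPow x (typeCount c.other p.2.1 (t - p.1)) *
        enatPow x (typeCount c.other p.2.2 (t - p.1)) with hF
  have hFm : Measurable F := by
    have hfactor := measurable_enatPow_typeCount x c.other
    have htime : Measurable fun p : ℝ × (Particle → ℝ) × (Particle → ℝ) => t - p.1 :=
      measurable_const.sub measurable_fst
    exact .ite (measurableSet_lt measurable_const measurable_fst) measurable_const
      ((hfactor.comp (measurable_snd.fst.prodMk htime)).mul
        (hfactor.comp (measurable_snd.snd.prodMk htime)))
  have hFint : Integrable F ((expMeasure 1).prod (lifetimeLaw.prod lifetimeLaw)) := by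
    refine .of_bound hFm.aestronglyMeasurable 1 (.of_forall fun p => ?_)
    simp only [hF]
    split_ifs
    · exact norm_mulSingle_le_one hx c
    · exact (norm_mul_le _ _).trans (mul_le_one₀ (norm_enatPow_le_one hx _) (norm_nonneg _)
        (norm_enatPow_le_one hx _))
  calc typePGF x c t
    _ = ∫ T, F (T [], subtreeLifetimes T false, subtreeLifetimes T true) ∂lifetimeLaw :=
      integral_congr_ae (ae_lifetimeLaw_nonneg.mono fun T hT => enatPow_typeCount x c hT ht)
    _ = ∫ p, F p ∂(expMeasure 1).prod (lifetimeLaw.prod lifetimeLaw) := by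
      rw [← map_root_subtreeLifetimes_lifetimeLaw, integral_map
        ((measurable_pi_apply _).prodMk ((measurable_subtreeLifetimes false).prodMk
          (measurable_subtreeLifetimes true))).aemeasurable hFm.aestronglyMeasurable]
    _ = ∫ s, ∫ q, F (s, q) ∂lifetimeLaw.prod lifetimeLaw ∂expMeasure 1 := integral_prod F hFint
    _ = _ := by
      congr with s
      simp only [hF]
      split_ifs
      · simp
      · rw [integral_prod_mul (fun T => enatPow x (typeCount c.other T (t - s)))
          fun T => enatPow x (typeCount c.other T (t - s)), sq]
        rfl

theorem integral_ite_lt_expMeasure {E : Type*} [NormedAddCommGroup E] [NormedSpace ℝ E]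
    [CompleteSpace E] {r t : ℝ} (hr : 0 < r) (ht : 0 ≤ t) (a : E) {f : ℝ → E}
    (hf : IntervalIntegrable f volume 0 t) :
    ∫ s, (if t < s then a else f (t - s)) ∂expMeasure r =
      Real.exp (-(r * t)) • (a + ∫ s in (0 : ℝ)..t, (r * Real.exp (r * s)) • f s) := by
  set g : ℝ → E := fun s => (r * Real.exp (-(r * s))) • if t < s then a else f (t - s) with hg
  have htail : EqOn g (fun s => (r * Real.exp (-r * s)) • a) (Ioi t) := fun s hs => by
    simp only [hg, if_pos (mem_Ioi.1 hs), neg_mul]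
  have hhead : EqOn g (fun s => (r * Real.exp (-(r * s))) • f (t - s)) (Ioc 0 t) := fun s hs => by
    simp only [hg, if_neg hs.2.not_gt]
  have hexp : IntegrableOn (fun s => (r * Real.exp (-r * s)) • a) (Ioi t) :=
    ((integrableOn_exp_mul_Ioi (neg_lt_zero.2 hr) t).const_mul r).smul_const a
  have hconv : IntervalIntegrable (fun s => (r * Real.exp (-(r * s))) • f (t - s)) volume 0 t :=
    (by simpa using (hf.comp_sub_left t).symm :
      IntervalIntegrable (fun s => f (t - s)) volume 0 t).continuousOn_smul (by fun_prop)
  have hsubst : ∫ s in (0 : ℝ)..t, (r * Real.exp (-(r * s))) • f (t - s) =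
      Real.exp (-(r * t)) • ∫ s in (0 : ℝ)..t, (r * Real.exp (r * s)) • f s := by
    have hcomp := intervalIntegral.integral_comp_sub_left (a := 0) (b := t)
      (fun s => (r * Real.exp (-(r * (t - s)))) • f s) t
    simp only [sub_sub_cancel, sub_self, sub_zero] at hcomp
    rw [hcomp, ← intervalIntegral.integral_smul]
    refine intervalIntegral.integral_congr fun s _ => ?_
    simp only [smul_smul, mul_left_comm _ r, ← Real.exp_add]
    ring_nf
  rw [integral_expMeasure hr.le, ← Ioc_union_Ioi_eq_Ioi ht,
    setIntegral_union Ioc_disjoint_Ioi_same measurableSet_Ioi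
      (((intervalIntegrable_iff_integrableOn_Ioc_of_le ht).1 hconv).congr_fun hhead.symm
        measurableSet_Ioc) (hexp.congr_fun htail.symm measurableSet_Ioi),
    setIntegral_congr_fun measurableSet_Ioc hhead, setIntegral_congr_fun measurableSet_Ioi htail,
    integral_smul_const, integral_const_mul, integral_exp_mul_Ioi (neg_lt_zero.2 hr),
    ← intervalIntegral.integral_of_le ht, hsubst, smul_add, add_comm, neg_mul]
  congr 2
  field_simp

theorem exp_smul_typePGF (hx : ‖x‖ ≤ 1) (c : Ball) {t : ℝ} (ht : 0 ≤ t) :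
    Real.exp t • typePGF x c t = (Pi.mulSingle Ball.x x : Ball → 𝕜) c +
      ∫ s in (0 : ℝ)..t, Real.exp s • typePGF x c.other s ^ 2 := by
  rw [typePGF_eq_integral_expMeasure hx c ht, integral_ite_lt_expMeasure one_pos ht _
    (intervalIntegrable_typePGF_sq hx c.other 0 t), smul_smul, ← Real.exp_add]
  simp

end TypePGF

/-! ### The backward equation -/

section BackwardEquation

variable {𝕜 : Type*} [RCLike 𝕜]

/-- The functions `g c` on `[0, ∞)`, one for each type, solve Kolmogorov's backward equation
`g_c' = g_{c.other} ^ 2 - g_c` of the two-type Yule process, with initial values `a c`. Derivatives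
are taken from the right. -/
structure IsBackwardSolution (a : Ball → 𝕜) (g : Ball → ℝ → 𝕜) : Prop where
  initial : ∀ c, g c 0 = a c
  continuousOn : ∀ c, ContinuousOn (g c) (Ici 0)
  hasDerivWithinAt : ∀ c, ∀ t ∈ Ici (0 : ℝ),
    HasDerivWithinAt (g c) (g c.other t ^ 2 - g c t) (Ici t) t

theorem IsBackwardSolution.eqOn {a : Ball → 𝕜} {g h : Ball → ℝ → 𝕜} (hg : IsBackwardSolution a g)
    (hh : IsBackwardSolution a h) (c : Ball) : EqOn (g c) (h c) (Ici 0) := by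
  intro t ht
  set v : 𝕜 × 𝕜 → 𝕜 × 𝕜 := fun p => (p.2 ^ 2 - p.1, p.1 ^ 2 - p.2)
  let pair (g : Ball → ℝ → 𝕜) (s : ℝ) : 𝕜 × 𝕜 := (g c s, g c.other s)
  have hcont {g} (hg : IsBackwardSolution a g) : ContinuousOn (pair g) (Icc 0 t) :=
    ((hg.continuousOn c).prodMk (hg.continuousOn c.other)).mono Icc_subset_Ici_self
  have hderiv {g} (hg : IsBackwardSolution a g) :
      ∀ s ∈ Ico 0 t, HasDerivWithinAt (pair g) (v (pair g s)) (Ici s) s := by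
    intro s hs
    have hother := hg.hasDerivWithinAt c.other s hs.1
    rw [Ball.other_eq_iff.2 rfl] at hother
    exact (hg.hasDerivWithinAt c s hs.1).prodMk hother
  obtain ⟨K, hK⟩ : ∃ K, LipschitzOnWith K v (pair g '' Icc 0 t ∪ pair h '' Icc 0 t) :=
    (show ContDiff ℝ 1 v by fun_prop).locallyLipschitz.locallyLipschitzOn
      |>.exists_lipschitzOnWith_of_compact ((isCompact_Icc.image_of_continuousOn (hcont hg)).union
        (isCompact_Icc.image_of_continuousOn (hcont hh)))
  have huniq := ODE_solution_unique_of_mem_Icc_right (v := fun _ => v) (fun _ _ => hK)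
    (hcont hg) (hderiv hg) (fun s hs => .inl (mem_image_of_mem _ (Ico_subset_Icc_self hs)))
    (hcont hh) (hderiv hh) (fun s hs => .inr (mem_image_of_mem _ (Ico_subset_Icc_self hs)))
    (by simp only [pair, hg.initial, hh.initial])
  exact congrArg Prod.fst (huniq ⟨ht, le_rfl⟩)

theorem hasDerivAt_exp_neg (t : ℝ) :
    HasDerivAt (fun t => Real.exp (-t)) (-Real.exp (-t)) t := by
  simpa using (hasDerivAt_neg t).exp

theorem isBackwardSolution_typePGF {x : 𝕜} (hx : ‖x‖ ≤ 1) :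
    IsBackwardSolution (Pi.mulSingle Ball.x x) (typePGF x) := by
  set I : Ball → ℝ → 𝕜 := fun c t => ∫ s in (0 : ℝ)..t, Real.exp s • typePGF x c.other s ^ 2 with hI
  have hint (c : Ball) (u v : ℝ) :
      IntervalIntegrable (fun s => Real.exp s • typePGF x c.other s ^ 2) volume u v :=
    (intervalIntegrable_typePGF_sq hx c.other u v).continuousOn_smul (by fun_prop)
  have heq (c : Ball) : EqOn (typePGF x c)
      (fun t => Real.exp (-t) • ((Pi.mulSingle Ball.x x : Ball → 𝕜) c + I c t)) (Ici 0) := by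
    intro t ht
    simp only [hI]
    rw [← exp_smul_typePGF hx c ht, smul_smul, ← Real.exp_add]
    simp
  have hcont (c : Ball) : ContinuousOn (typePGF x c) (Ici 0) := by
    have hIcont : Continuous (I c) := intervalIntegral.continuous_primitive (hint c) 0
    exact (show Continuous _ by fun_prop).continuousOn.congr (heq c)
  refine ⟨fun c => by simpa using exp_smul_typePGF hx c le_rfl, hcont, fun c t ht => ?_⟩
  have hIderiv : HasDerivWithinAt (I c) (Real.exp t • typePGF x c.other t ^ 2) (Ici t) t := by
    refine intervalIntegral.integral_hasDerivWithinAt_right (t := Ioi t) (hint c 0 t) ?_ ?_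
    · have hsm : StronglyMeasurable fun s => Real.exp s • typePGF x c.other s ^ 2 :=
        Real.continuous_exp.stronglyMeasurable.smul ((stronglyMeasurable_typePGF x c.other).pow 2)
      exact hsm.aestronglyMeasurable.stronglyMeasurableAtFilter
    · have := (hcont c.other t ht).mono (Ioi_subset_Ici ht)
      fun_prop
  refine (((hasDerivAt_exp_neg t).hasDerivWithinAt.smul (hIderiv.const_add _)).congr_of_mem
    ((heq c).mono (Ici_subset_Ici.2 ht)) self_mem_Ici).congr_deriv ?_
  have hpgf : typePGF x c t = Real.exp (-t) • ((Pi.mulSingle Ball.x x : Ball → 𝕜) c + I c t) :=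
    heq c ht
  rw [smul_smul, ← Real.exp_add, neg_smul, ← hpgf]
  simp [sub_eq_add_neg]

theorem one_sub_exp_neg_mem_Ico {t : ℝ} (ht : 0 ≤ t) : 1 - Real.exp (-t) ∈ Ico (0 : ℝ) 1 :=
  ⟨sub_nonneg.2 (Real.exp_le_one_iff.2 (neg_nonpos.2 ht)), sub_lt_self _ (Real.exp_pos _)⟩

theorem abs_one_sub_exp_neg_lt_one {t : ℝ} (ht : 0 ≤ t) : |1 - Real.exp (-t)| < 1 :=
  abs_lt.2 ⟨neg_one_lt_zero.trans_le (one_sub_exp_neg_mem_Ico ht).1,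
    (one_sub_exp_neg_mem_Ico ht).2⟩

theorem isBackwardSolution_urnSeries {w : Ball → 𝕜} (hw : ∀ b, ‖w b‖ ≤ 1) :
    IsBackwardSolution w fun c t => Real.exp (-t) • urnSeries w c (1 - Real.exp (-t)) := by
  have hderiv (c : Ball) {t : ℝ} (ht : 0 ≤ t) :
      HasDerivAt (fun t => Real.exp (-t) • urnSeries w c (1 - Real.exp (-t)))
        ((Real.exp (-t) • urnSeries w c.other (1 - Real.exp (-t))) ^ 2 -
          Real.exp (-t) • urnSeries w c (1 - Real.exp (-t))) t := by
    have hseries := (hasDerivAt_urnSeries hw c (abs_one_sub_exp_neg_lt_one ht)).scomp t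
      ((hasDerivAt_exp_neg t).const_sub 1)
    refine ((hasDerivAt_exp_neg t).smul hseries).congr_deriv ?_
    rw [neg_neg, neg_smul, ← sub_eq_add_neg, smul_smul, ← sq, ← smul_pow]
    rfl
  exact ⟨fun c => by simp [urnSeries_zero],
    fun c t ht => (hderiv c ht).continuousAt.continuousWithinAt,
    fun c t ht => (hderiv c ht).hasDerivWithinAt⟩

theorem typePGF_eq_urnSeries {x : 𝕜} (hx : ‖x‖ ≤ 1) (c : Ball) {t : ℝ} (ht : 0 ≤ t) :
    typePGF x c t = Real.exp (-t) • urnSeries (Pi.mulSingle Ball.x x) c (1 - Real.exp (-t)) :=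
  (isBackwardSolution_typePGF hx).eqOn
    (isBackwardSolution_urnSeries (norm_mulSingle_le_one hx)) c ht

theorem hasSum_yuleCount {Ω : Type*} [MeasurableSpace Ω] {μ : Measure Ω} [IsProbabilityMeasure μ]
    {T : Particle → Ω → ℝ} (hT : IsYuleLifetimes μ T) {x : 𝕜} (hx : ‖x‖ ≤ 1) {t : ℝ} (ht : 0 ≤ t) :
    HasSum (fun k : ℕ => (μ.real {ω | yuleCount (fun v => T v ω) t = (k : ℕ∞)} : 𝕜) * x ^ k)
      (Real.exp (-t) • urnSeries (Pi.mulSingle Ball.x x) Ball.x (1 - Real.exp (-t))) := by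
  have hcount : Measurable fun S : Particle → ℝ => yuleCount S t :=
    (measurable_typeCount Ball.x).comp measurable_prodMk_right
  have hsum := hasSum_measureReal_mul_pow
    (hcount.comp_aemeasurable hT.hasLaw_lifetimeLaw.aemeasurable) hx
  have hlaw : ∫ ω, enatPow x (yuleCount (fun v => T v ω) t) ∂μ = typePGF x Ball.x t :=
    hT.hasLaw_lifetimeLaw.integral_comp
      ((measurable_of_countable (enatPow x)).comp hcount).aestronglyMeasurable
  rw [← typePGF_eq_urnSeries hx Ball.x ht, ← hlaw]
  exact hsum

end BackwardEquation

end

theorem mainTheorem9 {Ω : Type*} [MeasurableSpace Ω] (μ : Measure Ω) [IsProbabilityMeasure μ]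
    (T : Particle → Ω → ℝ) (hT : IsYuleLifetimes μ T) (t : ℝ) (ht : 0 ≤ t) :
    (∀ x : ℂ, ‖x‖ ≤ 1 →
      Summable (fun p : ℕ × ℕ => (urnCount p.1 p.2 : ℂ) * x ^ p.2 *
        ((1 - Real.exp (-t) : ℝ) : ℂ) ^ p.1 / (p.1.factorial : ℂ)) ∧
      HasSum (fun k : ℕ => (μ.real {ω | yuleCount (fun v => T v ω) t = (k : ℕ∞)} : ℂ) * x ^ k)
        (Real.exp (-t) * ∑' p : ℕ × ℕ, (urnCount p.1 p.2 : ℂ) * x ^ p.2 *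
          ((1 - Real.exp (-t) : ℝ) : ℂ) ^ p.1 / (p.1.factorial : ℂ))) ∧
    (∀ x : ℝ, |x| < 1 →
      HasSum (fun k : ℕ => μ.real {ω | yuleCount (fun v => T v ω) t = (k : ℕ∞)} * x ^ k)
        (Real.exp (-t) * urnClosedForm x (1 - Real.exp (-t)))) := by
  have hz := one_sub_exp_neg_mem_Ico ht
  refine ⟨fun x hx => ?_, fun x hx => ?_⟩
  · have hurn := hasSum_urnCount_prod hx (abs_one_sub_exp_neg_lt_one ht)
    have hcount := hasSum_yuleCount hT hx ht
    rw [← hurn.tsum_eq, Complex.real_smul] at hcount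
    exact ⟨hurn.summable, hcount⟩
  · rw [urnClosedForm_eq_urnSeries (Ioo_subset_Ico_self (abs_lt.1 hx)) hz, ← smul_eq_mul]
    exact hasSum_yuleCount hT hx.le ht
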